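/- Let $X$ be a (real) Banach lattice and let $\mathcal S$ be a multiplicative semigroup of positive bounded linear operators on $X$ which is $\mathbb R_+$-closed (closed in the operator norm and under multiplication by positive scalars) and ideal irreducible (no closed order ideal of $X$ other than $\{0\}$ and $X$ is invariant under every operator in $\mathcal S$). Let $r$ be the minimal rank of the non-zero operators in $\mathcal S$, and assume that $r<\infty$ (so $\mathcal S$ contains a non-zero operator of finite rank). Let $\mathcal S_r$ be the set consisting of the operators of rank $r$ in $\mathcal S$ and of zero, and let $\mathcal P_r$ be the set of all projections $P=P^2$ of rank $r$ in $\mathcal S$. (A) The following are equivalent: 1. all projections in $\mathcal P_r$ have the same range; 2. all non-zero operators in $\mathcal S_r$ have the same range; 3. $S(\operatorname{Range}P)=\operatorname{Range}P$ for all non-zero $S\in\mathcal S$ and all $P\in\mathcal P_r$; 4. there is $P\in\mathcal P_r$ whose range is $\mathcal S$-invariant, i.e. $S(\operatorname{Range}P)\subseteq\operatorname{Range}P$ for all $S\in\mathcal S$. (B) The following are equivalent: 1. $\mathcal P_r$ consists of a single projection; 2. every $P\in\mathcal P_r$ commutes with every operator in $\mathcal S$; 3. some $P\in\mathcal P_r$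 commutes with every operator in $\mathcal S$. -/

import Mathlib

namespace PositiveSemigroup

section Operators

variable {X : Type*} [NormedAddCommGroup X] [NormedSpace ℝ X]

/-- The range of a bounded operator, as a linear subspace. -/
def range (T : X →L[ℝ] X) : Submodule ℝ X := LinearMap.range (T : X →ₗ[ℝ] X)

/-- The rank of a bounded operator: the dimension of its range, `⊤` if that is infinite. -/
noncomputable def rank (T : X →L[ℝ] X) : ℕ∞ := Cardinal.toENat (Module.rank ℝ (range T))

/-- The minimal rank of the non-zero elements of `S`; it is `⊤` if `S` contains no non-zero
operator of finite rank. -/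
noncomputable def minRank (S : Set (X →L[ℝ] X)) : ℕ∞ := ⨅ T ∈ S, ⨅ _ : T ≠ 0, rank T

/-- The operators in `S` that have rank `r` or are zero. -/
def rankPart (S : Set (X →L[ℝ] X)) (r : ℕ) : Set (X →L[ℝ] X) :=
  {T | T ∈ S ∧ (rank T = (r : ℕ∞) ∨ T = 0)}

/-- The projections (idempotents) of rank `r` in `S`. -/
def rankProj (S : Set (X →L[ℝ] X)) (r : ℕ) : Set (X →L[ℝ] X) :=
  {P | P ∈ S ∧ P * P = P ∧ rank P = (r : ℕ∞)}

/-- `S` is closed in the operator norm and under multiplication by positive scalars. -/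
structure IsRPlusClosed (S : Set (X →L[ℝ] X)) : Prop where
  isClosed : IsClosed S
  smul_mem : ∀ c : ℝ, 0 < c → ∀ T ∈ S, c • T ∈ S

variable [Lattice X]

/-- A positive operator: it maps the positive cone into itself. -/
def IsPositiveOp (T : X →L[ℝ] X) : Prop := ∀ x : X, 0 ≤ x → 0 ≤ T x

/-- A closed (order) ideal: a closed solid linear subspace. -/
def IsClosedIdeal (J : Submodule ℝ X) : Prop :=
  IsClosed (J : Set X) ∧ ∀ x y : X, y ∈ J → |x| ≤ |y| → x ∈ J

/-- `S` has no common invariant closed ideal other than `0` and the whole space. -/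
def IsIdealIrreducible (S : Set (X →L[ℝ] X)) : Prop :=
  ∀ J : Submodule ℝ X, IsClosedIdeal J → (∀ T ∈ S, ∀ x ∈ J, T x ∈ J) → J = ⊥ ∨ J = ⊤

end Operators

end PositiveSemigroup

open Filter Topology

/-! Two facts carry the proof. Ideal irreducibility makes the semigroup prime: for non-zero `A`, `B`
in `S` some `T` in `S` has `A T B ≠ 0` (`exists_mul_mul_ne_zero`). Minimality of `r` makes every
non-zero element of `S` with range inside that of a rank `r` operator share its range, so
compressions of `S` to such a range are zero or invertible. With `R_+`-closedness this yields
projections (`exists_mem_rankProj_of_mul_self_ne_zero`). Comparing the range of `A T P` with those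
of `A` and `P` then settles (A). In (B), uniqueness of the projection also determines kernels, and
equal ranges with equal kernels force commutation. -/

/-- In a finite-dimensional normed algebra, a closed set that is stable under positive scalars,
contains the powers of a unit `u` and has no non-zero non-unit contains the inverse of `u`. -/
theorem Units.inv_mem_of_isClosed {𝔸 : Type*} [NormedRing 𝔸] [NormedAlgebra ℝ 𝔸]
    [FiniteDimensional ℝ 𝔸] [Nontrivial 𝔸] (u : 𝔸ˣ) (M : Set 𝔸) (hM : IsClosed M)
    (hsmul : ∀ c : ℝ, 0 < c → ∀ w ∈ M, c • w ∈ M) (hpow : ∀ n : ℕ, (u : 𝔸) ^ n ∈ M)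
    (hunit : ∀ w ∈ M, w ≠ 0 → IsUnit w) : (↑u⁻¹ : 𝔸) ∈ M := by
  have : CompleteSpace 𝔸 := FiniteDimensional.complete ℝ 𝔸
  have : ProperSpace 𝔸 := FiniteDimensional.proper ℝ 𝔸
  have hne : ∀ n : ℕ, (u : 𝔸) ^ n ≠ 0 := fun n => by
    rw [← Units.val_pow_eq_pow_val]; exact Units.ne_zero _
  have hpos : ∀ n : ℕ, 0 < ‖(u : 𝔸) ^ n‖⁻¹ := fun n =>
    _root_.inv_pos.2 (norm_pos_iff.2 (hne n))
  let w : ℕ → 𝔸 := fun n => ‖(u : 𝔸) ^ n‖⁻¹ • (u : 𝔸) ^ n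
  obtain ⟨a, ha, φ, hφ, hlim⟩ := (isCompact_sphere (0 : 𝔸) 1).tendsto_subseq (x := w) (by
    intro n
    simp [w, norm_smul, (norm_pos_iff.2 (hne n)).ne'])
  have haM : a ∈ M := hM.mem_of_tendsto hlim
    (Eventually.of_forall fun k => hsmul _ (hpos _) _ (hpow _))
  obtain ⟨v, rfl⟩ := hunit a haM (by rintro rfl; simp at ha)
  have hinv : Tendsto (fun k => Ring.inverse (w (φ k))) atTop (𝓝 (↑v⁻¹ : 𝔸)) := by
    have := (NormedRing.inverse_continuousAt v).tendsto.comp hlim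
    rwa [Ring.inverse_unit] at this
  -- Consecutive terms of the subsequence have quotients tending to `1`, so dividing once more by
  -- `u` gives the limit `u⁻¹`.
  have hprod := ((hinv.mul (hlim.comp (tendsto_add_atTop_nat 1))).mul_const (↑u⁻¹ : 𝔸))
  rw [Units.inv_mul, one_mul] at hprod
  refine hM.mem_of_tendsto hprod (Eventually.of_forall fun k => ?_)
  -- The gap between indices is at least one, so the division by `u` still leaves a non-negative
  -- power `u ^ m`.
  obtain ⟨m, hm⟩ : ∃ m, φ (k + 1) = φ k + (m + 1) := by
    have := hφ (Nat.lt_succ_self k)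
    exact ⟨φ (k + 1) - φ k - 1, by simp only [Nat.succ_eq_add_one] at this; omega⟩
  have hw : Ring.inverse (w (φ k)) = ‖(u : 𝔸) ^ φ k‖ • (↑(u ^ φ k)⁻¹ : 𝔸) := by
    have hn := (norm_pos_iff.2 (hne (φ k))).ne'
    refine Ring.inverse_unit (⟨w (φ k), ‖(u : 𝔸) ^ φ k‖ • (↑(u ^ φ k)⁻¹ : 𝔸), ?_, ?_⟩ : 𝔸ˣ)
    · simp only [w]
      rw [smul_mul_smul_comm, ← Units.val_pow_eq_pow_val, Units.mul_inv, Units.val_pow_eq_pow_val,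
        inv_mul_cancel₀ hn, one_smul]
    · simp only [w]
      rw [smul_mul_smul_comm, ← Units.val_pow_eq_pow_val, Units.inv_mul, Units.val_pow_eq_pow_val,
        mul_inv_cancel₀ hn, one_smul]
  have : Ring.inverse (w (φ k)) * w (φ (k + 1)) * (↑u⁻¹ : 𝔸) =
      (‖(u : 𝔸) ^ φ k‖ * ‖(u : 𝔸) ^ φ (k + 1)‖⁻¹) • (u : 𝔸) ^ m := by
    rw [hw]
    simp only [w]
    rw [smul_mul_smul_comm, smul_mul_assoc]
    congr 1
    rw [← Units.val_pow_eq_pow_val, ← Units.val_pow_eq_pow_val, ← Units.val_mul, ← Units.val_mul,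
      hm]
    congr 1
    group
  simp only [Function.comp_apply]
  rw [this]
  exact hsmul _ (mul_pos (norm_pos_iff.2 (hne _)) (hpos _)) _ (hpow _)

namespace PositiveSemigroup

/-! ### Ranks, ranges and minimal rank projections -/

section Rank

variable {X : Type*} [NormedAddCommGroup X] [NormedSpace ℝ X]

theorem mem_range {T : X →L[ℝ] X} {y : X} : y ∈ range T ↔ ∃ x, T x = y := Iff.rfl

theorem apply_mem_range (T : X →L[ℝ] X) (x : X) : T x ∈ range T := ⟨x, rfl⟩

theorem apply_eq_self_of_mem_range {P : X →L[ℝ] X} (hP : P * P = P) {x : X} (hx : x ∈ range P) :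
    P x = x := by
  obtain ⟨y, rfl⟩ := mem_range.1 hx
  exact DFunLike.congr_fun hP y

theorem range_mul_le (A B : X →L[ℝ] X) : range (A * B) ≤ range A := by
  rintro _ ⟨x, rfl⟩
  exact ⟨B x, rfl⟩

theorem coe_range_mul (A B : X →L[ℝ] X) : (range (A * B) : Set X) = A '' (range B : Set X) :=
  Set.range_comp A B

theorem rank_mono {A B : X →L[ℝ] X} (h : range A ≤ range B) : rank A ≤ rank B :=
  Cardinal.toENat.monotone' (Submodule.rank_mono h)

theorem rank_mul_le_right (A B : X →L[ℝ] X) : rank (A * B) ≤ rank B := by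
  refine Cardinal.toENat.monotone' ?_
  have h : range (A * B) = (range B).map (A : X →ₗ[ℝ] X) := LinearMap.range_comp _ _
  rw [h]
  exact rank_map_le _ _

theorem finiteDimensional_of_rank_eq {A : X →L[ℝ] X} {r : ℕ} (h : rank A = r) :
    FiniteDimensional ℝ (range A) := by
  rw [rank, Cardinal.toENat_eq_natCast] at h
  exact Module.rank_lt_aleph0_iff.1 (h ▸ Cardinal.natCast_lt_aleph0)

theorem finrank_eq_of_rank_eq {A : X →L[ℝ] X} {r : ℕ} (h : rank A = r) :
    Module.finrank ℝ (range A) = r := by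
  rw [rank, Cardinal.toENat_eq_natCast] at h
  exact Module.finrank_eq_of_rank_eq h

theorem range_eq_of_le_of_rank_eq {A B : X →L[ℝ] X} {r : ℕ} (hA : rank A = r) (hB : rank B = r)
    (h : range A ≤ range B) : range A = range B := by
  have := finiteDimensional_of_rank_eq hB
  exact Submodule.eq_of_le_of_finrank_eq h
    ((finrank_eq_of_rank_eq hA).trans (finrank_eq_of_rank_eq hB).symm)

theorem minRank_le {S : Set (X →L[ℝ] X)} {T : X →L[ℝ] X} (hT : T ∈ S) (h0 : T ≠ 0) :
    minRank S ≤ rank T :=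
  iInf_le_of_le T (iInf_le_of_le hT (iInf_le _ h0))

theorem exists_rank_eq_minRank {S : Set (X →L[ℝ] X)} {r : ℕ} (hr : minRank S = r) :
    ∃ T ∈ S, T ≠ 0 ∧ rank T = r := by
  by_contra! h
  have : ((r + 1 : ℕ) : ℕ∞) ≤ minRank S := by
    refine le_iInf fun T => le_iInf fun hT => le_iInf fun h0 => ?_
    rw [Nat.cast_add, Nat.cast_one]
    exact Order.add_one_le_of_lt (lt_of_le_of_ne (hr ▸ minRank_le hT h0) (h T hT h0).symm)
  rw [hr, Nat.cast_le] at this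
  omega

variable {S : Subsemigroup (X →L[ℝ] X)} {r : ℕ}

theorem rank_eq_of_range_le (hr : minRank (S : Set (X →L[ℝ] X)) = r) {A B : X →L[ℝ] X}
    (hA : A ∈ S) (hA0 : A ≠ 0) (hB : rank B = r) (h : range A ≤ range B) : rank A = r :=
  le_antisymm (hB ▸ rank_mono h) (hr ▸ minRank_le hA hA0)

theorem range_eq_of_range_le (hr : minRank (S : Set (X →L[ℝ] X)) = r) {A B : X →L[ℝ] X}
    (hA : A ∈ S) (hA0 : A ≠ 0) (hB : rank B = r) (h : range A ≤ range B) : range A = range B :=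
  range_eq_of_le_of_rank_eq (rank_eq_of_range_le hr hA hA0 hB h) hB h

theorem rank_mul_eq_right (hr : minRank (S : Set (X →L[ℝ] X)) = r) {A B : X →L[ℝ] X}
    (hAB : A * B ∈ S) (h0 : A * B ≠ 0) (hB : rank B = r) : rank (A * B) = r :=
  le_antisymm (hB ▸ rank_mul_le_right A B) (hr ▸ minRank_le hAB h0)

/-- A non-zero operator of rank `r` excludes `r = 0`, the only rank for which the zero operator
would count as a projection of rank `r`. -/
theorem ne_zero_of_mem_rankProj {A P : X →L[ℝ] X} (hA0 : A ≠ 0) (hA : rank A = r)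
    (hP : P ∈ rankProj (S : Set (X →L[ℝ] X)) r) : P ≠ 0 := by
  rintro rfl
  have h0 : range (0 : X →L[ℝ] X) ≤ range A := by
    rintro _ ⟨x, rfl⟩
    exact (range A).zero_mem
  have h := range_eq_of_le_of_rank_eq hP.2.2 hA h0
  refine hA0 (ContinuousLinearMap.ext fun x => ?_)
  have hx := apply_mem_range A x
  rw [← h] at hx
  obtain ⟨y, hy⟩ := mem_range.1 hx
  simpa using hy.symm

theorem ne_zero_of_minRank_eq (hr : minRank (S : Set (X →L[ℝ] X)) = r) {P : X →L[ℝ] X}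
    (hP : P ∈ rankProj (S : Set (X →L[ℝ] X)) r) : P ≠ 0 := by
  obtain ⟨A, -, hA0, hAr⟩ := exists_rank_eq_minRank hr
  exact ne_zero_of_mem_rankProj hA0 hAr hP

/-- A minimal rank operator with non-zero square has the range and the kernel of a projection
of the semigroup. -/
theorem exists_mem_rankProj_of_mul_self_ne_zero
    (hclosed : IsRPlusClosed (S : Set (X →L[ℝ] X)))
    (hr : minRank (S : Set (X →L[ℝ] X)) = r) {B : X →L[ℝ] X} (hB : B ∈ S) (hBr : rank B = r)
    (hBB : B * B ≠ 0) :
    ∃ P ∈ rankProj (S : Set (X →L[ℝ] X)) r, range P = range B ∧ ∀ x, P x = 0 ↔ B x = 0 := by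
  have hfd := finiteDimensional_of_rank_eq hBr
  let ι : range B →L[ℝ] X := (range B).subtypeL
  let C : X →L[ℝ] range B := B.codRestrict (range B) (apply_mem_range B)
  let Φ : (range B →L[ℝ] range B) → (X →L[ℝ] X) := fun W => ι.comp (W.comp C)
  have hΦ : Continuous Φ := by fun_prop
  have hC : ∀ y : range B, ∃ x, C x = y := by
    rintro ⟨_, x, rfl⟩
    exact ⟨x, rfl⟩
  have hΦ0 : ∀ W, W ≠ 0 → Φ W ≠ 0 := by
    intro W hW h
    refine hW (ContinuousLinearMap.ext fun y => ?_)
    obtain ⟨x, rfl⟩ := hC y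
    exact Subtype.ext (DFunLike.congr_fun h x)
  have hΦrange : ∀ W, range (Φ W) ≤ range B := by
    rintro W _ ⟨x, rfl⟩
    exact (W (C x)).2
  -- By minimality `Φ W` fills `range B`, so `W` is onto and, in finite dimension, bijective.
  have hunit : ∀ W, Φ W ∈ S → W ≠ 0 → IsUnit W := by
    intro W hWS hW
    have heq := range_eq_of_range_le hr hWS (hΦ0 W hW) hBr (hΦrange W)
    have hsurj : Function.Surjective W := by
      intro y
      have hy : (y : X) ∈ range (Φ W) := by
        rw [heq]
        exact y.2
      obtain ⟨x, hx⟩ := mem_range.1 hy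
      exact ⟨C x, Subtype.ext hx⟩
    rw [ContinuousLinearMap.isUnit_iff_bijective]
    exact ⟨(LinearMap.injective_iff_surjective (f := (W : range B →ₗ[ℝ] range B))).2 hsurj, hsurj⟩
  let U : range B →L[ℝ] range B := C.comp ι
  -- `Φ (U ^ n)` is `B ^ (n + 1)`: the exponent `0` gives `B`, so `S` need not contain the identity.
  have hpow : ∀ n : ℕ, Φ (U ^ n) ∈ S := by
    intro n
    induction n with
    | zero => exact hB
    | succ n ih =>
      have : Φ (U ^ (n + 1)) = Φ (U ^ n) * B := by
        rw [pow_succ]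
        rfl
      rw [this]
      exact S.mul_mem ih hB
  have hU0 : U ≠ 0 := by
    intro h
    refine hBB (ContinuousLinearMap.ext fun x => ?_)
    exact congrArg Subtype.val (DFunLike.congr_fun h (C x))
  have hnt : Nontrivial (range B →L[ℝ] range B) := ⟨⟨U, 0, hU0⟩⟩
  obtain ⟨u, hu⟩ := hunit U (by simpa using hpow 1) hU0
  have hinv : (↑u⁻¹ : range B →L[ℝ] range B) ∈ Φ ⁻¹' (S : Set (X →L[ℝ] X)) := by
    refine Units.inv_mem_of_isClosed (𝔸 := range B →L[ℝ] range B) u _ (hclosed.isClosed.preimage hΦ) ?_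
      (fun n => by rw [hu]; exact hpow n) hunit
    intro c hc W hW
    have : Φ (c • W) = c • Φ W := by
      ext x
      simp [Φ]
    rw [Set.mem_preimage, this]
    exact hclosed.smul_mem c hc _ hW
  have hker : ∀ x, Φ ↑u⁻¹ x = 0 ↔ B x = 0 := by
    intro x
    have huu : ∀ y, (u : range B →L[ℝ] range B) ((↑u⁻¹ : range B →L[ℝ] range B) y) = y :=
      fun y => DFunLike.congr_fun u.mul_inv y
    constructor
    · intro h
      have h1 : (↑u⁻¹ : range B →L[ℝ] range B) (C x) = 0 := Subtype.ext h
      have h2 := huu (C x)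
      rw [h1, map_zero] at h2
      exact (congrArg Subtype.val h2).symm
    · intro h
      have h1 : C x = 0 := Subtype.ext h
      simp [Φ, h1]
  -- The projection is `Φ U⁻¹ = ι U⁻¹ C`; it is idempotent because `C ι = U`.
  have hP0 : Φ ↑u⁻¹ ≠ 0 := hΦ0 _ (Units.ne_zero _)
  refine ⟨Φ ↑u⁻¹, ⟨hinv, ?_, ?_⟩, ?_, hker⟩
  · ext x
    have h := DFunLike.congr_fun u.mul_inv (C x)
    rw [hu] at h
    change ι ((↑u⁻¹ : range B →L[ℝ] range B) (U ((↑u⁻¹ : range B →L[ℝ] range B) (C x)))) = _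
    exact congrArg (fun y => ι ((↑u⁻¹ : range B →L[ℝ] range B) y)) h
  · exact rank_eq_of_range_le hr hinv hP0 hBr (hΦrange _)
  · exact range_eq_of_range_le hr hinv hP0 hBr (hΦrange _)

end Rank

/-! ### Positive operators and ideal irreducibility -/

section Lattice

variable {X : Type*} [NormedAddCommGroup X] [NormedSpace ℝ X] [Lattice X]

theorem IsPositiveOp.mul {A B : X →L[ℝ] X} (hA : IsPositiveOp A) (hB : IsPositiveOp B) :
    IsPositiveOp (A * B) :=
  fun x hx => hA _ (hB x hx)

theorem abs_real_smul_le [IsOrderedModule ℝ X] (c : ℝ) (x : X) : |c • x| ≤ |c| • |x| := by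
  have key : ∀ c : ℝ, c • x ≤ |c| • |x| := by
    intro c
    rcases le_total 0 c with hc | hc
    · rw [abs_of_nonneg hc]
      exact smul_le_smul_of_nonneg_left (le_abs_self x) hc
    · rw [abs_of_nonpos hc, ← neg_smul_neg c x]
      exact smul_le_smul_of_nonneg_left (neg_le_abs x) (neg_nonneg.2 hc)
  refine abs_le'.2 ⟨key c, ?_⟩
  rw [← neg_smul, ← abs_neg c]
  exact key (-c)

variable [IsOrderedAddMonoid X]

theorem IsPositiveOp.mono {T : X →L[ℝ] X} (hT : IsPositiveOp T) {x y : X} (h : x ≤ y) :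
    T x ≤ T y := by
  simpa using hT (y - x) (sub_nonneg.2 h)

theorem IsPositiveOp.abs_apply_le {T : X →L[ℝ] X} (hT : IsPositiveOp T) (x : X) :
    |T x| ≤ T |x| := by
  refine abs_le'.2 ⟨hT.mono (le_abs_self x), ?_⟩
  rw [← map_neg]
  exact hT.mono (neg_le_abs x)

theorem IsPositiveOp.apply_abs_eq_zero {T : X →L[ℝ] X} (hT : IsPositiveOp T) {x y : X}
    (h : |x| ≤ y) (hy : T y = 0) : T |x| = 0 :=
  le_antisymm (hy ▸ hT.mono h) (hT _ (abs_nonneg x))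

variable [IsOrderedModule ℝ X]

/-- The common absolute kernel of a family of positive operators. -/
def absKer (F : Set (X →L[ℝ] X)) (hF : ∀ A ∈ F, IsPositiveOp A) : Submodule ℝ X where
  carrier := {x | ∀ A ∈ F, A |x| = 0}
  zero_mem' := fun A _ => by simp
  add_mem' := fun {x y} hx hy A hA =>
    (hF A hA).apply_abs_eq_zero (abs_add_le x y) (by rw [map_add, hx A hA, hy A hA, add_zero])
  smul_mem' := fun c x hx A hA =>
    (hF A hA).apply_abs_eq_zero (abs_real_smul_le c x) (by rw [map_smul, hx A hA, smul_zero])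

variable [HasSolidNorm X]

theorem isClosedIdeal_absKer (F : Set (X →L[ℝ] X)) (hF : ∀ A ∈ F, IsPositiveOp A) :
    IsClosedIdeal (absKer F hF) := by
  refine ⟨?_, fun x y hy hxy A hA => (hF A hA).apply_abs_eq_zero hxy (hy A hA)⟩
  have h : (absKer F hF : Set X) = ⋂ A ∈ F, {x | A |x| = 0} := by
    ext x
    simp [absKer]
  rw [h]
  refine isClosed_biInter fun A _ => isClosed_eq ?_ continuous_const
  have habs : Continuous fun x : X => |x| := continuous_id.sup continuous_neg
  exact A.continuous.comp habs

variable {S : Subsemigroup (X →L[ℝ] X)}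

/-- Otherwise `x` lies in the common absolute kernel of all `A T`, a closed ideal that is invariant
because `S` absorbs products. -/
theorem exists_apply_abs_ne_zero (hpos : ∀ T ∈ S, IsPositiveOp T)
    (hirr : IsIdealIrreducible (S : Set (X →L[ℝ] X))) {A : X →L[ℝ] X} (hA : A ∈ S) (hA0 : A ≠ 0)
    {x : X} (hx : x ≠ 0) : ∃ T ∈ S, A (T |x|) ≠ 0 := by
  by_contra! h
  have hF : ∀ B ∈ {B | ∃ T ∈ S, B = A * T}, IsPositiveOp B := by
    rintro _ ⟨T, hT, rfl⟩
    exact (hpos A hA).mul (hpos T hT)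
  have hJ := hirr (absKer _ hF) (isClosedIdeal_absKer _ hF) (by
    rintro T hT y hy _ ⟨R, hR, rfl⟩
    refine ((hpos A hA).mul (hpos R hR)).apply_abs_eq_zero ((hpos T hT).abs_apply_le y) ?_
    exact hy _ ⟨R * T, S.mul_mem hR hT, rfl⟩)
  have hxJ : x ∈ absKer _ hF := by
    rintro _ ⟨T, hT, rfl⟩
    exact h T hT
  rcases hJ with hJ | hJ
  · rw [hJ, Submodule.mem_bot] at hxJ
    exact hx hxJ
  · have hAT : ∀ T ∈ S, ∀ y : X, A (T |y|) = 0 := by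
      intro T hT y
      have hy : y ∈ absKer _ hF := hJ ▸ Submodule.mem_top
      exact hy _ ⟨T, hT, rfl⟩
    -- Now every `A T` vanishes. As `S` may lack an identity, irreducibility is applied again, to
    -- the absolute kernel of `A`, which contains the range of every `T` in `S`, in particular that
    -- of `A`.
    have hG : ∀ B ∈ ({A} : Set (X →L[ℝ] X)), IsPositiveOp B := by
      rintro _ rfl
      exact hpos _ hA
    have hN := hirr (absKer _ hG) (isClosedIdeal_absKer _ hG) (by
      rintro T hT y - _ rfl
      exact (hpos _ hA).apply_abs_eq_zero ((hpos T hT).abs_apply_le y) (hAT T hT y))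
    obtain ⟨z, hz⟩ := DFunLike.ne_iff.1 hA0
    rcases hN with hN | hN
    · have hmem : A z ∈ absKer _ hG := by
        rintro _ rfl
        exact (hpos _ hA).apply_abs_eq_zero ((hpos _ hA).abs_apply_le z) (hAT _ hA z)
      rw [hN, Submodule.mem_bot] at hmem
      exact hz hmem
    · have hmem : z ∈ absKer _ hG := hN ▸ Submodule.mem_top
      have habs := le_antisymm (((hpos A hA).abs_apply_le z).trans (hmem A rfl).le) (abs_nonneg _)
      refine hz (norm_eq_zero.1 ?_)
      rw [← norm_abs_eq_norm, habs, norm_zero]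

theorem exists_mul_mul_ne_zero (hpos : ∀ T ∈ S, IsPositiveOp T)
    (hirr : IsIdealIrreducible (S : Set (X →L[ℝ] X))) {A B : X →L[ℝ] X} (hA : A ∈ S)
    (hA0 : A ≠ 0) (hB : B ∈ S) (hB0 : B ≠ 0) : ∃ T ∈ S, A * (T * B) ≠ 0 := by
  obtain ⟨y, hy⟩ := DFunLike.ne_iff.1 hB0
  obtain ⟨T, hT, h⟩ := exists_apply_abs_ne_zero hpos hirr hA hA0 hy
  refine ⟨T, hT, fun h0 => h ?_⟩
  have h1 : A (T (B |y|)) = 0 := DFunLike.congr_fun h0 |y|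
  exact ((hpos A hA).mul (hpos T hT)).apply_abs_eq_zero ((hpos B hB).abs_apply_le y) h1

variable {r : ℕ}

/-- If `A T A ≠ 0`, then `A T` has the range of `A` by minimality and does not vanish on it, so its
square is non-zero. -/
theorem exists_mem_rankProj_range_eq (hpos : ∀ T ∈ S, IsPositiveOp T)
    (hclosed : IsRPlusClosed (S : Set (X →L[ℝ] X)))
    (hirr : IsIdealIrreducible (S : Set (X →L[ℝ] X)))
    (hr : minRank (S : Set (X →L[ℝ] X)) = r) {A : X →L[ℝ] X} (hA : A ∈ S) (hA0 : A ≠ 0)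
    (hAr : rank A = r) : ∃ P ∈ rankProj (S : Set (X →L[ℝ] X)) r, range P = range A := by
  obtain ⟨T, hT, h⟩ := exists_mul_mul_ne_zero hpos hirr hA hA0 hA hA0
  have hAT : A * T ∈ S := S.mul_mem hA hT
  have hAT0 : A * T ≠ 0 := fun h0 => h (by rw [← mul_assoc, h0, zero_mul])
  have hrank := rank_eq_of_range_le hr hAT hAT0 hAr (range_mul_le A T)
  have hrange := range_eq_of_range_le hr hAT hAT0 hAr (range_mul_le A T)
  obtain ⟨P, hP, hPr, -⟩ := exists_mem_rankProj_of_mul_self_ne_zero hclosed hr hAT hrank (by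
    intro h0
    refine h (ContinuousLinearMap.ext fun x => ?_)
    have hx := apply_mem_range A x
    rw [← hrange] at hx
    obtain ⟨y, hy⟩ := mem_range.1 hx
    have h1 : A (T ((A * T) y)) = 0 := DFunLike.congr_fun h0 y
    rwa [hy] at h1)
  exact ⟨P, hP, hPr.trans hrange⟩

theorem exists_mem_rankProj (hpos : ∀ T ∈ S, IsPositiveOp T)
    (hclosed : IsRPlusClosed (S : Set (X →L[ℝ] X)))
    (hirr : IsIdealIrreducible (S : Set (X →L[ℝ] X)))
    (hr : minRank (S : Set (X →L[ℝ] X)) = r) : ∃ P, P ∈ rankProj (S : Set (X →L[ℝ] X)) r := by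
  obtain ⟨A, hA, hA0, hAr⟩ := exists_rank_eq_minRank hr
  obtain ⟨P, hP, -⟩ := exists_mem_rankProj_range_eq hpos hclosed hirr hr hA hA0 hAr
  exact ⟨P, hP⟩

/-- A non-zero `A T P` has range inside both `range A` and, by invariance, `range P`; minimality
makes both inclusions equalities. -/
theorem range_eq_of_invariant (hpos : ∀ T ∈ S, IsPositiveOp T)
    (hirr : IsIdealIrreducible (S : Set (X →L[ℝ] X)))
    (hr : minRank (S : Set (X →L[ℝ] X)) = r) {P A : X →L[ℝ] X}
    (hP : P ∈ rankProj (S : Set (X →L[ℝ] X)) r)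
    (hinv : ∀ T ∈ S, ∀ x ∈ range P, T x ∈ range P) (hA : A ∈ S) (hA0 : A ≠ 0) (hAr : rank A = r) :
    range A = range P := by
  obtain ⟨T, hT, h⟩ := exists_mul_mul_ne_zero hpos hirr hA hA0 hP.1 (ne_zero_of_minRank_eq hr hP)
  have hmem : A * (T * P) ∈ S := S.mul_mem hA (S.mul_mem hT hP.1)
  rw [← range_eq_of_range_le hr hmem h hAr (range_mul_le _ _)]
  refine range_eq_of_range_le hr hmem h hP.2.2 ?_
  rintro _ ⟨x, rfl⟩
  exact hinv A hA _ (hinv T hT _ (apply_mem_range P x))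

theorem image_range_eq_of_range_eq (hpos : ∀ T ∈ S, IsPositiveOp T)
    (hirr : IsIdealIrreducible (S : Set (X →L[ℝ] X)))
    (hr : minRank (S : Set (X →L[ℝ] X)) = r)
    (h : ∀ A ∈ rankPart (S : Set (X →L[ℝ] X)) r, A ≠ 0 →
      ∀ B ∈ rankPart (S : Set (X →L[ℝ] X)) r, B ≠ 0 → range A = range B)
    {T : X →L[ℝ] X} (hT : T ∈ S) (hT0 : T ≠ 0) {P : X →L[ℝ] X}
    (hP : P ∈ rankProj (S : Set (X →L[ℝ] X)) r) :
    T '' (range P : Set X) = (range P : Set X) := by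
  have hP0 := ne_zero_of_minRank_eq hr hP
  obtain ⟨R, hR, hne⟩ := exists_mul_mul_ne_zero hpos hirr hT hT0 hP.1 hP0
  have hrange : ∀ Q ∈ S, Q * P ≠ 0 → range (Q * P) = range P := fun Q hQ hQ0 =>
    h _ ⟨S.mul_mem hQ hP.1, Or.inl (rank_mul_eq_right hr (S.mul_mem hQ hP.1) hQ0 hP.2.2)⟩ hQ0
      _ ⟨hP.1, Or.inl hP.2.2⟩ hP0
  -- Since `R P` has the same range as `P`, `T R P ≠ 0` forces `T P ≠ 0`.
  have hRP := hrange R hR fun h0 => hne (by rw [h0, mul_zero])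
  rw [← coe_range_mul, hrange T hT]
  intro h0
  refine hne (ContinuousLinearMap.ext fun x => ?_)
  have hx := apply_mem_range (R * P) x
  rw [hRP] at hx
  obtain ⟨y, hy⟩ := mem_range.1 hx
  have h1 : T (P y) = 0 := DFunLike.congr_fun h0 y
  rwa [hy] at h1

/-! ### The two lists of equivalences -/

theorem tfae_range (hpos : ∀ T ∈ S, IsPositiveOp T)
    (hclosed : IsRPlusClosed (S : Set (X →L[ℝ] X)))
    (hirr : IsIdealIrreducible (S : Set (X →L[ℝ] X)))
    (hr : minRank (S : Set (X →L[ℝ] X)) = r) :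
    List.TFAE [
      ∀ P ∈ rankProj (S : Set (X →L[ℝ] X)) r, ∀ Q ∈ rankProj (S : Set (X →L[ℝ] X)) r,
        range P = range Q,
      ∀ A ∈ rankPart (S : Set (X →L[ℝ] X)) r, A ≠ 0 →
        ∀ B ∈ rankPart (S : Set (X →L[ℝ] X)) r, B ≠ 0 → range A = range B,
      ∀ T ∈ S, T ≠ 0 → ∀ P ∈ rankProj (S : Set (X →L[ℝ] X)) r,
        T '' (range P : Set X) = (range P : Set X),
      ∃ P ∈ rankProj (S : Set (X →L[ℝ] X)) r, ∀ T ∈ S, ∀ x ∈ range P, T x ∈ range P] := by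
  tfae_have 1 → 2 := by
    rintro h A ⟨hA, hAr⟩ hA0 B ⟨hB, hBr⟩ hB0
    obtain ⟨P, hP, hPA⟩ :=
      exists_mem_rankProj_range_eq hpos hclosed hirr hr hA hA0 (hAr.resolve_right hA0)
    obtain ⟨Q, hQ, hQB⟩ :=
      exists_mem_rankProj_range_eq hpos hclosed hirr hr hB hB0 (hBr.resolve_right hB0)
    rw [← hPA, ← hQB, h P hP Q hQ]
  tfae_have 2 → 3 := fun h T hT hT0 P hP =>
    image_range_eq_of_range_eq hpos hirr hr h hT hT0 hP
  tfae_have 3 → 4 := by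
    intro h
    obtain ⟨P, hP⟩ := exists_mem_rankProj hpos hclosed hirr hr
    refine ⟨P, hP, fun T hT x hx => ?_⟩
    rcases eq_or_ne T 0 with rfl | hT0
    · exact (range P).zero_mem
    · have : T x ∈ T '' (range P : Set X) := ⟨x, hx, rfl⟩
      rwa [h T hT hT0 P hP] at this
  tfae_have 4 → 1 := by
    rintro ⟨P, hP, hinv⟩ Q hQ R hR
    rw [range_eq_of_invariant hpos hirr hr hP hinv hQ.1 (ne_zero_of_minRank_eq hr hQ) hQ.2.2,
      range_eq_of_invariant hpos hirr hr hP hinv hR.1 (ne_zero_of_minRank_eq hr hR) hR.2.2]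
  tfae_finish

theorem tfae_commute (hpos : ∀ T ∈ S, IsPositiveOp T)
    (hclosed : IsRPlusClosed (S : Set (X →L[ℝ] X)))
    (hirr : IsIdealIrreducible (S : Set (X →L[ℝ] X)))
    (hr : minRank (S : Set (X →L[ℝ] X)) = r) :
    List.TFAE [
      ∃ P, rankProj (S : Set (X →L[ℝ] X)) r = {P},
      ∀ P ∈ rankProj (S : Set (X →L[ℝ] X)) r, ∀ T ∈ S, P * T = T * P,
      ∃ P ∈ rankProj (S : Set (X →L[ℝ] X)) r, ∀ T ∈ S, P * T = T * P] := by
  tfae_have 1 → 2 := by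
    rintro ⟨P, hsing⟩ P' hP' T hT
    obtain rfl : P' = P := by rwa [hsing] at hP'
    rcases eq_or_ne T 0 with rfl | hT0
    · rw [mul_zero, zero_mul]
    have himage : T '' (range P' : Set X) = (range P' : Set X) := by
      have hrange : ∀ P ∈ rankProj (S : Set (X →L[ℝ] X)) r,
          ∀ Q ∈ rankProj (S : Set (X →L[ℝ] X)) r, range P = range Q := by
        intro P hP Q hQ
        rw [hsing] at hP hQ
        rw [hP, hQ]
      have h := (List.TFAE.out (tfae_range hpos hclosed hirr hr) 0 2 rfl rfl).1 hrange
      exact h T hT hT0 P' hP'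
    have hTP : ∀ x, P' (T (P' x)) = T (P' x) := by
      intro x
      refine apply_eq_self_of_mem_range hP'.2.1 ?_
      have : T (P' x) ∈ T '' (range P' : Set X) := ⟨_, apply_mem_range P' x, rfl⟩
      rwa [himage] at this
    -- `T` maps `range P'` onto itself, so the square of `P' T` still covers `range P'`.
    have hne : P' * T * (P' * T) ≠ 0 := by
      intro h0
      refine ne_zero_of_minRank_eq hr hP' (ContinuousLinearMap.ext fun x => ?_)
      obtain ⟨y, hy, hyx⟩ : P' x ∈ T '' (range P' : Set X) := by
        rw [himage]
        exact apply_mem_range P' x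
      obtain ⟨z, hz, rfl⟩ : y ∈ T '' (range P' : Set X) := by
        rw [himage]
        exact hy
      have h1 : P' (T (P' (T z))) = 0 := DFunLike.congr_fun h0 z
      rwa [apply_eq_self_of_mem_range hP'.2.1 hy, hyx,
        apply_eq_self_of_mem_range hP'.2.1 (apply_mem_range P' x)] at h1
    have hmem : P' * T ∈ S := S.mul_mem hP'.1 hT
    -- `Q` has the kernel of `P' T`. Uniqueness gives `Q = P'`, so `P' T` kills `x - P' x`, whence
    -- `P' T = P' T P' = T P'`.
    obtain ⟨Q, hQ, -, hker⟩ := exists_mem_rankProj_of_mul_self_ne_zero hclosed hr hmem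
      (rank_eq_of_range_le hr hmem (fun h0 => hne (by rw [h0, zero_mul])) hP'.2.2
        (range_mul_le _ _)) hne
    obtain rfl : Q = P' := by rwa [hsing] at hQ
    ext x
    have hx : Q (x - Q x) = 0 := by
      rw [map_sub, apply_eq_self_of_mem_range hP'.2.1 (apply_mem_range Q x), sub_self]
    have h1 : Q (T (x - Q x)) = 0 := (hker _).1 hx
    rw [map_sub, map_sub, hTP, sub_eq_zero] at h1
    exact h1
  tfae_have 2 → 3 := by
    intro h
    obtain ⟨P, hP⟩ := exists_mem_rankProj hpos hclosed hirr hr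
    exact ⟨P, hP, h P hP⟩
  tfae_have 3 → 1 := by
    rintro ⟨P, hP, hcomm⟩
    refine ⟨P, Set.eq_singleton_iff_unique_mem.2 ⟨hP, fun Q hQ => ?_⟩⟩
    have hinv : ∀ T ∈ S, ∀ x ∈ range P, T x ∈ range P := by
      rintro T hT _ ⟨x, rfl⟩
      exact ⟨T x, DFunLike.congr_fun (hcomm T hT) x⟩
    have hrange := range_eq_of_invariant hpos hirr hr hP hinv hQ.1
      (ne_zero_of_minRank_eq hr hQ) hQ.2.2
    have h1 : P * Q = Q := ContinuousLinearMap.ext fun x =>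
      apply_eq_self_of_mem_range hP.2.1 (hrange ▸ apply_mem_range Q x)
    have h2 : Q * P = P := ContinuousLinearMap.ext fun x =>
      apply_eq_self_of_mem_range hQ.2.1 (hrange ▸ apply_mem_range P x)
    rw [← h1, hcomm Q hQ.1, h2]
  tfae_finish

end Lattice

end PositiveSemigroup

theorem mainTheorem12 {X : Type*} [NormedAddCommGroup X] [NormedSpace ℝ X] [CompleteSpace X]
    [Lattice X] [IsOrderedAddMonoid X] [IsOrderedModule ℝ X] [HasSolidNorm X]
    (S : Subsemigroup (X →L[ℝ] X))
    (hpos : ∀ T ∈ S, PositiveSemigroup.IsPositiveOp T)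
    (hclosed : PositiveSemigroup.IsRPlusClosed (S : Set (X →L[ℝ] X)))
    (hirr : PositiveSemigroup.IsIdealIrreducible (S : Set (X →L[ℝ] X)))
    (r : ℕ) (hr : PositiveSemigroup.minRank (S : Set (X →L[ℝ] X)) = (r : ℕ∞)) :
    List.TFAE [
      ∀ P ∈ PositiveSemigroup.rankProj (S : Set (X →L[ℝ] X)) r,
        ∀ Q ∈ PositiveSemigroup.rankProj (S : Set (X →L[ℝ] X)) r,
          PositiveSemigroup.range P = PositiveSemigroup.range Q,
      ∀ A ∈ PositiveSemigroup.rankPart (S : Set (X →L[ℝ] X)) r, A ≠ 0 →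
        ∀ B ∈ PositiveSemigroup.rankPart (S : Set (X →L[ℝ] X)) r, B ≠ 0 →
          PositiveSemigroup.range A = PositiveSemigroup.range B,
      ∀ T ∈ S, T ≠ 0 → ∀ P ∈ PositiveSemigroup.rankProj (S : Set (X →L[ℝ] X)) r,
        T '' (PositiveSemigroup.range P : Set X) = (PositiveSemigroup.range P : Set X),
      ∃ P ∈ PositiveSemigroup.rankProj (S : Set (X →L[ℝ] X)) r,
        ∀ T ∈ S, ∀ x ∈ PositiveSemigroup.range P, T x ∈ PositiveSemigroup.range P] ∧
    List.TFAE [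
      ∃ P, PositiveSemigroup.rankProj (S : Set (X →L[ℝ] X)) r = {P},
      ∀ P ∈ PositiveSemigroup.rankProj (S : Set (X →L[ℝ] X)) r, ∀ T ∈ S, P * T = T * P,
      ∃ P ∈ PositiveSemigroup.rankProj (S : Set (X →L[ℝ] X)) r, ∀ T ∈ S, P * T = T * P] := by
  exact ⟨PositiveSemigroup.tfae_range hpos hclosed hirr hr,
    PositiveSemigroup.tfae_commute hpos hclosed hirr hr⟩
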